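/- **Theorem 8 (Asymptotic exactness of multivariate Cheap Bootstrap).** Let $d\ge 1$ and $B\ge d$ be integers and $\alpha\in(0,1)$. Let $X_1,X_2,\dots$ be i.i.d. with distribution $P$ on a measurable space, and let $\psi(\cdot)$ be an $\mathbb R^d$-valued functional on probability distributions such that $\psi\big(\tfrac1n\sum_{i\le n}\delta_{x_i}\big)$ is a measurable function of $(x_1,\dots,x_n)$ for every $n\ge1$. Write $\psi=\psi(P)$, $\hat P_n=\frac1n\sum_{i=1}^n\delta_{X_i}$ and $\hat\psi_n=\psi(\hat P_n)$. For each $n$ and $b=1,\dots,B$ let $X_1^{*b},\dots,X_n^{*b}$ be drawn uniformly with replacement from $\{X_1,\dots,X_n\}$, all $nB$ draws being independent of each other and of the data (in terms of the indices drawn), and let $\psi_n^{*b}=\psi\big(\frac1n\sum_{i=1}^n\delta_{X_i^{*b}}\big)$. Assume that for some positive definite $\Sigma\in\mathbb R^{d\times d}$, as $n\to\infty$, $\sqrt n(\hat\psi_n-\psi)\Rightarrow N(0,\Sigma)$, and for a resample estimate $\psi_n^*$ (each $\psi_n^{*b}$) $\sqrt n(\psi_n^{*}-\hat\psi_n)\Rightarrow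 N(0,\Sigma)$ conditionally on the data in probability, i.e., for every $x\in\mathbb R^d$, with componentwise inequalities, $$\mathbb P\big(\sqrt n(\psi_n^{*}-\hat\psi_n)\le x\,\big|\,X_1,\dots,X_n\big)\ \xrightarrow{\ p\ }\ \mathbb P\big(N(0,\Sigma)\le x\big).$$ Let $S=\frac1B\sum_{b=1}^B(\psi_n^{*b}-\hat\psi_n)(\psi_n^{*b}-\hat\psi_n)^\top$, and let $T^2_{d,B,1-\alpha}$ be the $(1-\alpha)$-quantile of Hotelling's $T^2$ distribution with parameters $d$ and $B$, that is, of the law of $Z_0^\top\big(\frac1B\sum_{b=1}^BZ_bZ_b^\top\big)^{-1}Z_0$ with $Z_0,\dots,Z_B$ i.i.d. $N(0,I_d)$. Then, as $n\to\infty$, $S$ is invertible with probability tending to $1$, and the region $$\mathcal R=\big\{\theta\in\mathbb R^d:(\hat\psi_n-\theta)^\top S^{-1}(\hat\psi_n-\theta)\le T^2_{d,B,1-\alpha}\big\}$$ is an asymptotically exact $(1-\alpha)$-level confidence region for $\psi$: $$\mathbb P_n(\psi\in\mathcal R)\to1-\alpha,$$ where $\mathbb P_n$ is the probability with respect to the data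 and all randomness of the resampling. (When $S$ is singular, $S^{-1}$ is read as $0$; by the preceding assertion this does not affect the limit.) -/

import Mathlib

open MeasureTheory ProbabilityTheory Filter
open scoped Topology ENNReal Matrix

noncomputable section

namespace CheapBootstrap

/-- The empirical distribution `n⁻¹ ∑ᵢ δ_{xᵢ}` of the points `x₀, …, xₙ₋₁`, `n ≥ 1`. -/
def empirical {𝒳 : Type*} [MeasurableSpace 𝒳] {n : ℕ+} (x : Fin n → 𝒳) :
    ProbabilityMeasure 𝒳 :=
  ⟨((n : ℕ) : ℝ≥0∞)⁻¹ • ∑ i, Measure.dirac (x i), ⟨by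
    have h0 : ((n : ℕ) : ℝ≥0∞) ≠ 0 := Nat.cast_ne_zero.mpr n.ne_zero
    simp [ENNReal.inv_mul_cancel h0 (ENNReal.natCast_ne_top _)]⟩⟩

/-- The original data set of size `n`, as a random point of `𝒳ⁿ`. -/
def data {𝒳 Ω : Type*} (X : ℕ → Ω → 𝒳) (n : ℕ+) (ω : Ω) : Fin n → 𝒳 :=
  fun i => X i ω

/-- The σ-algebra generated by the first `n` data points. -/
abbrev dataSigma {𝒳 Ω : Type*} [MeasurableSpace 𝒳] (X : ℕ → Ω → 𝒳) (n : ℕ+) :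
    MeasurableSpace Ω :=
  MeasurableSpace.comap (data X n) inferInstance

/-- The point estimate: the functional `ψ` evaluated at the empirical distribution. -/
def estimate {𝒳 Ω : Type*} [MeasurableSpace 𝒳] {d : ℕ}
    (ψ : ProbabilityMeasure 𝒳 → EuclideanSpace ℝ (Fin d)) (X : ℕ → Ω → 𝒳)
    (n : ℕ+) (ω : Ω) : EuclideanSpace ℝ (Fin d) :=
  ψ (empirical (data X n ω))

/-- The `b`-th resample estimate: `ψ` evaluated at the empirical distribution of the resample
whose `i`-th point is the data point with index `J n b i`. -/
def resampleEstimate {𝒳 Ω : Type*} [MeasurableSpace 𝒳] {d B : ℕ}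
    (ψ : ProbabilityMeasure 𝒳 → EuclideanSpace ℝ (Fin d)) (X : ℕ → Ω → 𝒳)
    (J : (n : ℕ+) → Fin B → Fin n → Ω → Fin n)
    (n : ℕ+) (b : Fin B) (ω : Ω) : EuclideanSpace ℝ (Fin d) :=
  ψ (empirical fun i : Fin n => data X n ω (J n b i ω))

/-- For every sample size `n`, the resampling indices `J n b i` (`b < B`, `i < n`) describe `B`
resamples with replacement: they are independent, uniform on `{0, …, n - 1}`, and jointly
independent of the data `X₀, …, Xₙ₋₁`. -/
structure IsResampling {𝒳 Ω : Type*} [MeasurableSpace 𝒳] [MeasurableSpace Ω] {B : ℕ}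
    (μ : Measure Ω) (X : ℕ → Ω → 𝒳) (J : (n : ℕ+) → Fin B → Fin n → Ω → Fin n) : Prop where
  measurable : ∀ (n : ℕ+) b i, Measurable (J n b i)
  uniform : ∀ (n : ℕ+) b i, μ.map (J n b i) = uniformOn Set.univ
  indep : ∀ n : ℕ+, iIndepFun (fun (p : Fin B × Fin n) => J n p.1 p.2) μ
  indep_data : ∀ n : ℕ+, IndepFun (data X n) (fun ω (p : Fin B × Fin n) => J n p.1 p.2 ω) μ

/-- Convergence in distribution to `ν`, conditionally given the σ-algebras `𝒢 n`, in probability: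
the conditional distribution function of `Y n` given `𝒢 n` converges in probability, at every
point, to the distribution function of `ν`. (For limits `ν` whose distribution function is
continuous, such as nondegenerate normal distributions.) -/
def CondTendstoInDistribution {Ω : Type*} [MeasurableSpace Ω] {d : ℕ} (μ : Measure Ω)
    (Y : ℕ+ → Ω → EuclideanSpace ℝ (Fin d)) (𝒢 : ℕ+ → MeasurableSpace Ω)
    (ν : Measure (EuclideanSpace ℝ (Fin d))) : Prop :=
  ∀ x : EuclideanSpace ℝ (Fin d),
    TendstoInMeasure μ (fun n => μ⟦{ω | ∀ i, Y n ω i ≤ x i} | 𝒢 n⟧) atTop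
      (fun _ => ν.real {z | ∀ i, z i ≤ x i})

/-- The second-moment matrix `B⁻¹ ∑_b v_b v_bᵀ` of the vectors `v_b`. -/
def secondMoment {d B : ℕ} (v : Fin B → EuclideanSpace ℝ (Fin d)) : Matrix (Fin d) (Fin d) ℝ :=
  (B : ℝ)⁻¹ • ∑ b, Matrix.vecMulVec (v b).ofLp (v b).ofLp

/-- The quadratic form `uᵀ M⁻¹ u`. -/
def invForm {d : ℕ} (M : Matrix (Fin d) (Fin d) ℝ) (u : EuclideanSpace ℝ (Fin d)) : ℝ :=
  u.ofLp ⬝ᵥ (M⁻¹ *ᵥ u.ofLp)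

/-- Hotelling's `T²` distribution with parameters `d` and `B`: the law of
`B · Z₀ᵀ W⁻¹ Z₀ = Z₀ᵀ (B⁻¹ W)⁻¹ Z₀`, where `W = ∑_b Z_b Z_bᵀ` (a Wishart matrix with `B` degrees
of freedom) and `Z₀, Z₁, …, Z_B` are independent standard normal vectors in `ℝᵈ`. -/
def hotelling (d B : ℕ) : Measure ℝ :=
  ((stdGaussian (EuclideanSpace ℝ (Fin d))).prod
      (Measure.pi fun _ : Fin B => stdGaussian (EuclideanSpace ℝ (Fin d)))).map
    fun z => invForm (secondMoment z.2) z.1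

/-- The `p`-quantile `inf {x | μ (-∞, x] ≥ p}` of a probability measure on `ℝ`, `0 < p < 1`. -/
def quantile (μ : Measure ℝ) (p : ℝ) : ℝ :=
  sInf {x : ℝ | p ≤ μ.real (Set.Iic x)}

/-- The resample covariance matrix, centered at the point estimate. -/
def resampleCov {𝒳 Ω : Type*} [MeasurableSpace 𝒳] {d B : ℕ}
    (ψ : ProbabilityMeasure 𝒳 → EuclideanSpace ℝ (Fin d)) (X : ℕ → Ω → 𝒳)
    (J : (n : ℕ+) → Fin B → Fin n → Ω → Fin n) (n : ℕ+) (ω : Ω) : Matrix (Fin d) (Fin d) ℝ :=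
  secondMoment fun b : Fin B => resampleEstimate ψ X J n b ω - estimate ψ X n ω

/-- The Cheap Bootstrap confidence region of nominal level `1 - α`. -/
def region {𝒳 Ω : Type*} [MeasurableSpace 𝒳] {d B : ℕ}
    (ψ : ProbabilityMeasure 𝒳 → EuclideanSpace ℝ (Fin d)) (X : ℕ → Ω → 𝒳)
    (J : (n : ℕ+) → Fin B → Fin n → Ω → Fin n) (α : ℝ) (n : ℕ+) (ω : Ω) :
    Set (EuclideanSpace ℝ (Fin d)) :=
  {θ | invForm (resampleCov ψ X J n ω) (estimate ψ X n ω - θ) ≤ quantile (hotelling d B) (1 - α)}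

end CheapBootstrap

end

/-!
Conditionally on the data the resample estimates are independent, so the joint distribution
function of `√n (ψ̂ₙ - ψ)` and the `√n (ψₙ^{*b} - ψ̂ₙ)` is the integral, over the event that
`√n (ψ̂ₙ - ψ)` lies in an orthant, of a product of conditional distribution functions. By assumption
that product converges in probability to a constant, so the `B + 1` vectors converge jointly to
independent `N(0, Σ)` vectors. The statistic `(u, v) ↦ uᵀ (B⁻¹ ∑_b v_b v_bᵀ)⁻¹ u` is invariant under
`(u, v) ↦ (A u, A v)` for invertible `A`: the scaling `√n` therefore drops out of the region, and
the limit law is the Hotelling distribution. It remains to see that the limit does not charge the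
boundaries of the events in question: `B ≥ d` independent vectors with a density almost surely span
`ℝᵈ`, and then the statistic is a positive definite quadratic form in the independent vector `u`,
whose level sets are Lebesgue null.
-/

namespace CheapBootstrap

section DistributionFunctions

lemma isPiSystem_range_Iic {γ : Type*} [SemilatticeInf γ] :
    IsPiSystem (Set.range (Set.Iic : γ → Set γ)) := by
  rintro _ ⟨a, rfl⟩ _ ⟨b, rfl⟩ -
  exact ⟨a ⊓ b, Set.Iic_inter_Iic.symm⟩

lemma pi_univ_Ioc_eq_sdiff {κ : Type*} [DecidableEq κ] {γ : κ → Type*} [∀ k, LinearOrder (γ k)]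
    (a b : ∀ k, γ k) :
    (Set.univ.pi fun k => Set.Ioc (a k) (b k)) =
      Set.Iic b \ ⋃ k, Set.Iic (Function.update b k (a k)) := by
  ext z
  simp only [Set.mem_univ_pi, Set.mem_Ioc, Set.mem_sdiff, Set.mem_Iic, Set.mem_iUnion, not_exists,
    le_update_iff, not_and']
  constructor
  · exact fun hz => ⟨fun k => (hz k).2, fun k _ => not_le.2 (hz k).1⟩
  · exact fun hz k => ⟨not_le.1 (hz.2 k fun j _ => hz.1 j), hz.1 k⟩

variable {κ ι : Type*} [Finite κ] {l : Filter ι}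

lemma tendsto_measureReal_pi_univ_Ioc {ν' : ι → Measure (κ → ℝ)} {ν : Measure (κ → ℝ)}
    [∀ i, IsFiniteMeasure (ν' i)] [IsFiniteMeasure ν]
    (h : ∀ x, Tendsto (fun i => (ν' i).real (Set.Iic x)) l (𝓝 (ν.real (Set.Iic x))))
    {a b : κ → ℝ} (hab : a ≤ b) :
    Tendsto (fun i => (ν' i).real (Set.univ.pi fun k => Set.Ioc (a k) (b k))) l
      (𝓝 (ν.real (Set.univ.pi fun k => Set.Ioc (a k) (b k)))) := by
  classical
  have := Fintype.ofFinite κ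
  have hunion : Tendsto (fun i => (ν' i).real (⋃ k, Set.Iic (Function.update b k (a k)))) l
      (𝓝 (ν.real (⋃ k, Set.Iic (Function.update b k (a k))))) := by
    have := isPiSystem_range_Iic.tendsto_measureReal_biUnion (μ := ν') (ν := ν) (l := l)
      (t := Finset.univ.image fun k => Set.Iic (Function.update b k (a k)))
      (by simp) (by rintro _ ⟨x, rfl⟩; exact measurableSet_Iic) (by rintro _ ⟨x, rfl⟩; exact h x)
    simpa only [Finset.set_biUnion_finset_image, Finset.mem_univ, Set.iUnion_true] using this
  have hsub : ⋃ k, Set.Iic (Function.update b k (a k)) ⊆ Set.Iic b :=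
    Set.iUnion_subset fun k =>
      Set.Iic_subset_Iic.2 (update_le_iff.2 ⟨hab k, fun _ _ => le_rfl⟩)
  have hmeas : MeasurableSet (⋃ k, Set.Iic (Function.update b k (a k))) :=
    .iUnion fun k => measurableSet_Iic
  have hsdiff (m : Measure (κ → ℝ)) [IsFiniteMeasure m] := measureReal_sdiff (μ := m) hsub hmeas
  simp_rw [pi_univ_Ioc_eq_sdiff, hsdiff]
  exact (h b).sub hunion

lemma tendsto_probabilityMeasure_of_tendsto_Iic [l.IsCountablyGenerated]
    {ν' : ι → ProbabilityMeasure (κ → ℝ)} {ν : ProbabilityMeasure (κ → ℝ)}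
    (h : ∀ x, Tendsto (fun i => (ν' i : Measure (κ → ℝ)).real (Set.Iic x)) l
      (𝓝 ((ν : Measure (κ → ℝ)).real (Set.Iic x)))) :
    Tendsto ν' l (𝓝 ν) := by
  have := Fintype.ofFinite κ
  refine (IsPiSystem.pi fun _ : κ => isPiSystem_Ioc (id : ℝ → ℝ) id)
    |>.tendsto_probabilityMeasure_of_tendsto_of_mem ?_ ?_ ?_
  · rintro _ ⟨s, hs, rfl⟩
    refine .univ_pi fun k => ?_
    obtain ⟨a, b, -, hab⟩ := hs k trivial
    exact hab ▸ measurableSet_Ioc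
  · intro u hu x hx
    obtain ⟨ε, hε, hball⟩ := Metric.isOpen_iff.1 hu x hx
    refine ⟨Set.univ.pi fun k => Set.Ioc (x k - ε / 2) (x k + ε / 2),
      ⟨_, fun k _ => ⟨x k - ε / 2, x k + ε / 2, by simp only [id]; linarith, rfl⟩, rfl⟩,
      set_pi_mem_nhds Set.finite_univ fun k _ => Ioc_mem_nhds (by linarith) (by linarith), ?_⟩
    refine fun z hz => hball ((dist_pi_lt_iff hε).2 fun k => ?_)
    have hk := hz k trivial
    rw [Real.dist_eq, abs_lt]
    constructor <;> linarith [hk.1, hk.2]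
  · rintro _ ⟨s, hs, rfl⟩
    choose a b hab hs using fun k => hs k trivial
    obtain rfl : (fun k => Set.Ioc (a k) (b k)) = s := funext hs
    exact NNReal.tendsto_coe.1 (tendsto_measureReal_pi_univ_Ioc h fun k => (hab k).le)

lemma tendsto_probabilityMeasure_of_tendsto_preimage_Iic [l.IsCountablyGenerated] {E : Type*}
    [TopologicalSpace E] [MeasurableSpace E] [BorelSpace E] (e : E ≃ₜ (κ → ℝ))
    {ν' : ι → ProbabilityMeasure E} {ν : ProbabilityMeasure E}
    (h : ∀ x, Tendsto (fun i => (ν' i : Measure E).real (e ⁻¹' Set.Iic x)) l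
      (𝓝 ((ν : Measure E).real (e ⁻¹' Set.Iic x)))) :
    Tendsto ν' l (𝓝 ν) := by
  have he : Measurable e := e.continuous.measurable
  have hmap : Tendsto (fun i => (ν' i).map he.aemeasurable) l (𝓝 (ν.map he.aemeasurable)) := by
    refine tendsto_probabilityMeasure_of_tendsto_Iic fun x => ?_
    simp only [ProbabilityMeasure.toMeasure_map, map_measureReal_apply he measurableSet_Iic]
    exact h x
  have hinv (m : ProbabilityMeasure E) :
      (m.map he.aemeasurable).map e.symm.continuous.measurable.aemeasurable = m := by
    ext1
    simp only [ProbabilityMeasure.toMeasure_map]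
    rw [Measure.map_map e.symm.continuous.measurable he, e.symm_comp_self, Measure.map_id]
  simpa only [hinv] using
    ProbabilityMeasure.tendsto_map_of_tendsto_of_continuous _ _ hmap e.symm.continuous

end DistributionFunctions

section Orthants

variable {ι κ : Type*}

/-- The lower orthant with corner `x`, so that `x ↦ ν.real (orthant x)` is the distribution
function of `ν`; `EuclideanSpace` has no order of its own to make this an interval. -/
def orthant (x : EuclideanSpace ℝ ι) : Set (EuclideanSpace ℝ ι) :=
  {z | ∀ i, z i ≤ x i}

lemma measurableSet_orthant [Countable ι] (x : EuclideanSpace ℝ ι) : MeasurableSet (orthant x) := by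
  simp only [orthant, Set.ofPred_forall]
  exact .iInter fun i => measurableSet_le (by fun_prop) measurable_const

lemma convex_orthant (x : EuclideanSpace ℝ ι) : Convex ℝ (orthant x) := by
  intro y hy z hz a b ha hb hab i
  calc a * y i + b * z i ≤ a * x i + b * x i := by gcongr; exacts [hy i, hz i]
    _ = x i := by rw [← add_mul, hab, one_mul]

/-- The coordinates of a vector and of a family of vectors, listed jointly, through which
convergence in law of the pair reduces to distribution functions on `ι ⊕ κ × ι → ℝ`. -/
def jointCoords (ι κ : Type*) :
    EuclideanSpace ℝ ι × (κ → EuclideanSpace ℝ ι) ≃ₜ (ι ⊕ κ × ι → ℝ) where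
  toFun p := Sum.elim p.1 fun q => p.2 q.1 q.2
  invFun z := (WithLp.toLp 2 fun i => z (.inl i), fun b => WithLp.toLp 2 fun i => z (.inr (b, i)))
  left_inv _ := rfl
  right_inv z := by ext (i | q) <;> rfl
  continuous_toFun := continuous_pi <| by rintro (i | q) <;> simp only [Sum.elim] <;> fun_prop
  continuous_invFun := by fun_prop

lemma jointCoords_preimage_Iic (z : ι ⊕ κ × ι → ℝ) :
    jointCoords ι κ ⁻¹' Set.Iic z = orthant ((jointCoords ι κ).symm z).1 ×ˢ
      Set.univ.pi fun b => orthant (((jointCoords ι κ).symm z).2 b) := by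
  ext p
  simp only [Set.mem_preimage, Set.mem_Iic, Pi.le_def, Sum.forall, Prod.forall, Set.mem_prod,
    Set.mem_univ_pi]
  rfl

lemma tendstoInDistribution_prod_pi_of_tendsto_orthant [Finite ι] [Fintype κ]
    {Ω S : Type*} [MeasurableSpace Ω] {μ : Measure Ω} [IsProbabilityMeasure μ]
    {l : Filter S} [l.IsCountablyGenerated]
    {ν₀ : Measure (EuclideanSpace ℝ ι)} [IsProbabilityMeasure ν₀]
    {ν : κ → Measure (EuclideanSpace ℝ ι)} [∀ b, IsProbabilityMeasure (ν b)]
    {U : S → Ω → EuclideanSpace ℝ ι} {D : S → κ → Ω → EuclideanSpace ℝ ι}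
    (hU : ∀ n, Measurable (U n)) (hD : ∀ n b, Measurable (D n b))
    (h : ∀ x (y : κ → EuclideanSpace ℝ ι),
      Tendsto (fun n => μ.real {ω | U n ω ∈ orthant x ∧ ∀ b, D n b ω ∈ orthant (y b)}) l
        (𝓝 (ν₀.real (orthant x) * ∏ b, (ν b).real (orthant (y b))))) :
    TendstoInDistribution (fun n ω => (U n ω, fun b => D n b ω)) l id (fun _ => μ)
      (ν₀.prod (Measure.pi ν)) := by
  have hUD (n) : Measurable fun ω => (U n ω, fun b => D n b ω) :=
    (hU n).prodMk (measurable_pi_lambda _ (hD n))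
  refine ⟨fun n => (hUD n).aemeasurable, aemeasurable_id, ?_⟩
  refine tendsto_probabilityMeasure_of_tendsto_preimage_Iic (jointCoords ι κ) fun z => ?_
  simp only [ProbabilityMeasure.coe_mk, Measure.map_id]
  have hmeas : MeasurableSet (jointCoords ι κ ⁻¹' Set.Iic z) :=
    (jointCoords ι κ).continuous.measurable measurableSet_Iic
  simp_rw [map_measureReal_apply (hUD _) hmeas, jointCoords_preimage_Iic,
    measureReal_prod_prod, measureReal_def (Measure.pi ν), Measure.pi_pi, ENNReal.toReal_prod]
  refine (h _ _).congr fun n => ?_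
  congr 1
  ext ω
  simp

end Orthants

section ConvergenceInMeasure

variable {Ω ι : Type*} [MeasurableSpace Ω] {μ : Measure Ω} {l : Filter ι}

lemma tendstoInMeasure_pi {κ : Type*} [Fintype κ] {E : κ → Type*} [∀ b, PseudoEMetricSpace (E b)]
    {F : ι → Ω → ∀ b, E b} {f : Ω → ∀ b, E b}
    (h : ∀ b, TendstoInMeasure μ (fun i ω => F i ω b) l fun ω => f ω b) :
    TendstoInMeasure μ F l f := by
  intro ε hε
  have hsum : Tendsto (fun i => ∑ b, μ {ω | ε ≤ edist (F i ω b) (f ω b)}) l (𝓝 0) := by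
    simpa only [Finset.sum_const_zero] using tendsto_finsetSum Finset.univ fun b _ => h b ε hε
  refine tendsto_of_tendsto_of_tendsto_of_le_of_le tendsto_const_nhds hsum (fun _ => zero_le)
    fun i => (measure_mono fun ω hω => ?_).trans (measure_iUnion_fintype_le μ _)
  by_contra hlt
  simp only [Set.mem_iUnion, Set.mem_ofPred_eq, not_exists, not_le] at hω hlt
  exact hω.not_gt ((Finset.sup_lt_iff hε).2 fun b _ => hlt b)

lemma tendsto_integral_norm_comp_sub_of_tendstoInMeasure [IsFiniteMeasure μ]
    [l.IsCountablyGenerated] {E G : Type*} [PseudoEMetricSpace E] [NormedAddCommGroup G]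
    {F : ι → Ω → E} {c : E} {φ : E → G} {R : ℝ} (h : TendstoInMeasure μ F l fun _ => c)
    (hφ : ContinuousAt φ c) (hmeas : ∀ i, AEStronglyMeasurable (fun ω => φ (F i ω)) μ)
    (hR : ∀ i, ∀ᵐ ω ∂μ, ‖φ (F i ω)‖ ≤ R) :
    Tendsto (fun i => ∫ ω, ‖φ (F i ω) - φ c‖ ∂μ) l (𝓝 0) := by
  refine tendsto_of_subseq_tendsto fun ns hns => ?_
  obtain ⟨ms, -, hms⟩ := (h.comp hns).exists_seq_tendsto_ae'
  refine ⟨ms, ?_⟩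
  rw [← integral_zero Ω ℝ (μ := μ)]
  refine tendsto_integral_of_dominated_convergence (fun _ => R + ‖φ c‖)
    (fun n => ((hmeas _).sub aestronglyMeasurable_const).norm) (integrable_const _)
    (fun n => ?_) ?_
  · filter_upwards [hR (ns (ms n))] with ω hω
    rw [norm_norm]
    exact (norm_sub_le _ _).trans (by gcongr)
  · filter_upwards [hms] with ω hω
    simpa only [Function.comp_def, sub_self, norm_zero] using
      ((hφ.tendsto.comp hω).sub_const (φ c)).norm

lemma tendsto_setIntegral_of_tendsto_integral_abs_sub [IsFiniteMeasure μ] {A : ι → Set Ω}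
    {G : ι → Ω → ℝ} {a c : ℝ} (hA : Tendsto (fun i => μ.real (A i)) l (𝓝 a))
    (hG : ∀ i, Integrable (G i) μ) (h : Tendsto (fun i => ∫ ω, |G i ω - c| ∂μ) l (𝓝 0)) :
    Tendsto (fun i => ∫ ω in A i, G i ω ∂μ) l (𝓝 (a * c)) := by
  have hdiff : Tendsto (fun i => ∫ ω in A i, (G i ω - c) ∂μ) l (𝓝 0) :=
    squeeze_zero_norm (fun i => (norm_integral_le_integral_norm _).trans <|
      setIntegral_le_integral ((hG i).sub (integrable_const c)).norm
        (ae_of_all _ fun _ => norm_nonneg _)) h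
  have hsplit (i) : ∫ ω in A i, (G i ω - c) ∂μ + μ.real (A i) * c = ∫ ω in A i, G i ω ∂μ := by
    rw [integral_sub (hG i).integrableOn (integrable_const c), setIntegral_const, smul_eq_mul,
      sub_add_cancel]
  simpa only [hsplit, zero_add] using hdiff.add (hA.mul_const c)

end ConvergenceInMeasure

section ConditionalIndependence

variable {Ω α β : Type*} [MeasurableSpace Ω] [MeasurableSpace α] [MeasurableSpace β]
  {μ : Measure Ω} [IsProbabilityMeasure μ] {Y : Ω → α}

lemma measureReal_inter_eq_setIntegral_section {V : Ω → β} (hY : Measurable Y) (hV : Measurable V)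
    (hYV : IndepFun Y V μ) {A : Set α} (hA : MeasurableSet A) {s : Set (α × β)}
    (hs : MeasurableSet s) :
    μ.real {ω | Y ω ∈ A ∧ (Y ω, V ω) ∈ s} =
      ∫ ω in Y ⁻¹' A, (μ.map V).real (Prod.mk (Y ω) ⁻¹' s) ∂μ := by
  have := Measure.isProbabilityMeasure_map (μ := μ) hV.aemeasurable
  have hlaw : μ.map (fun ω => (Y ω, V ω)) = (μ.map Y).prod (μ.map V) :=
    (indepFun_iff_map_prod_eq_prod_map_map hY.aemeasurable hV.aemeasurable).1 hYV
  have hsec : Measurable fun y => (μ.map V) (Prod.mk y ⁻¹' s) := measurable_measure_prodMk_left hs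
  have hlintegral : μ {ω | Y ω ∈ A ∧ (Y ω, V ω) ∈ s} =
      ∫⁻ ω in Y ⁻¹' A, (μ.map V) (Prod.mk (Y ω) ⁻¹' s) ∂μ :=
    calc μ {ω | Y ω ∈ A ∧ (Y ω, V ω) ∈ s}
        = μ.map (fun ω => (Y ω, V ω)) (s ∩ A ×ˢ Set.univ) := by
          rw [Measure.map_apply (hY.prodMk hV) (hs.inter (hA.prod .univ))]
          congr 1
          ext ω
          simp [and_comm]
      _ = (((μ.map Y).restrict A).prod (μ.map V)) s := by
          rw [hlaw, ← Measure.restrict_apply hs, ← Measure.prod_restrict, Measure.restrict_univ]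
      _ = ∫⁻ ω in Y ⁻¹' A, (μ.map V) (Prod.mk (Y ω) ⁻¹' s) ∂μ := by
          rw [Measure.prod_apply hs, setLIntegral_map hA hsec hY]
  rw [measureReal_def, hlintegral]
  exact (integral_toReal (hsec.comp hY).aemeasurable (ae_of_all _ fun _ => measure_lt_top _ _)).symm

lemma condExp_indicator_ae_eq_of_indepFun {V : Ω → β} (hY : Measurable Y) (hV : Measurable V)
    (hYV : IndepFun Y V μ) {s : Set (α × β)} (hs : MeasurableSet s) :
    μ⟦{ω | (Y ω, V ω) ∈ s} | MeasurableSpace.comap Y inferInstance⟧ =ᵐ[μ]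
      fun ω => (μ.map V).real (Prod.mk (Y ω) ⁻¹' s) := by
  have := Measure.isProbabilityMeasure_map (μ := μ) hV.aemeasurable
  have hsec : Measurable fun y => (μ.map V).real (Prod.mk y ⁻¹' s) :=
    (measurable_measure_prodMk_left hs).ennreal_toReal
  have hset : MeasurableSet {ω | (Y ω, V ω) ∈ s} := (hY.prodMk hV) hs
  have hint : Integrable (fun ω => (μ.map V).real (Prod.mk (Y ω) ⁻¹' s)) μ :=
    .of_bound (hsec.comp hY).aestronglyMeasurable 1 <| ae_of_all _ fun ω => by
      rw [Real.norm_of_nonneg measureReal_nonneg]; exact measureReal_le_one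
  refine (ae_eq_condExp_of_forall_setIntegral_eq hY.comap_le
    ((integrable_const (1 : ℝ)).indicator hset) (fun _ _ _ => hint.integrableOn) ?_
    (hsec.comp (comap_measurable Y)).aestronglyMeasurable).symm
  rintro _ ⟨A, hA, rfl⟩ -
  rw [← measureReal_inter_eq_setIntegral_section hY hV hYV hA hs, setIntegral_indicator hset,
    setIntegral_const, smul_eq_mul, mul_one]
  rfl

variable {κ : Type*} [Fintype κ] {K : κ → Ω → β}

lemma condExp_indicator_forall_ae_eq_prod (hY : Measurable Y) (hK : ∀ b, Measurable (K b))
    (hKind : iIndepFun K μ) (hYK : IndepFun Y (fun ω b => K b ω) μ)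
    {s : κ → Set (α × β)} (hs : ∀ b, MeasurableSet (s b)) :
    μ⟦{ω | ∀ b, (Y ω, K b ω) ∈ s b} | MeasurableSpace.comap Y inferInstance⟧ =ᵐ[μ]
      fun ω => ∏ b, (μ⟦{ω | (Y ω, K b ω) ∈ s b} | MeasurableSpace.comap Y inferInstance⟧) ω := by
  have (b : κ) := Measure.isProbabilityMeasure_map (μ := μ) (hK b).aemeasurable
  have hs' : MeasurableSet {p : α × (κ → β) | ∀ b, (p.1, p.2 b) ∈ s b} := by
    simp only [Set.ofPred_forall]
    exact .iInter fun b => (measurable_fst.prodMk (measurable_pi_apply b |>.comp measurable_snd))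
      (hs b)
  have hmarg : ∀ᵐ ω ∂μ, ∀ b,
      (μ⟦{ω | (Y ω, K b ω) ∈ s b} | MeasurableSpace.comap Y inferInstance⟧) ω =
        (μ.map (K b)).real (Prod.mk (Y ω) ⁻¹' s b) :=
    ae_all_iff.2 fun b => condExp_indicator_ae_eq_of_indepFun hY (hK b)
      (hYK.comp measurable_id (measurable_pi_apply b)) (hs b)
  filter_upwards [hmarg, condExp_indicator_ae_eq_of_indepFun hY (measurable_pi_lambda _ hK) hYK hs']
    with ω hω hjoint
  simp only [hω]
  refine hjoint.trans ?_
  rw [hKind.map_fun_eq_pi_map fun b => (hK b).aemeasurable]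
  simp only [measureReal_def, ← ENNReal.toReal_prod, ← Measure.pi_pi]
  congr 2
  ext k
  simp

lemma measureReal_inter_forall_eq_setIntegral_prod_condExp (hY : Measurable Y)
    (hK : ∀ b, Measurable (K b)) (hKind : iIndepFun K μ) (hYK : IndepFun Y (fun ω b => K b ω) μ)
    {A : Set α} (hA : MeasurableSet A) {s : κ → Set (α × β)} (hs : ∀ b, MeasurableSet (s b)) :
    μ.real {ω | Y ω ∈ A ∧ ∀ b, (Y ω, K b ω) ∈ s b} = ∫ ω in Y ⁻¹' A, ∏ b,
      (μ⟦{ω | (Y ω, K b ω) ∈ s b} | MeasurableSpace.comap Y inferInstance⟧) ω ∂μ := by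
  have hset : MeasurableSet {ω | ∀ b, (Y ω, K b ω) ∈ s b} := by
    simp only [Set.ofPred_forall]
    exact .iInter fun b => (hY.prodMk (hK b)) (hs b)
  rw [← integral_congr_ae
      (ae_restrict_of_ae (condExp_indicator_forall_ae_eq_prod hY hK hKind hYK hs)),
    setIntegral_condExp hY.comap_le ((integrable_const _).indicator hset) ⟨A, hA, rfl⟩,
    setIntegral_indicator hset, setIntegral_const, smul_eq_mul, mul_one]
  rfl

end ConditionalIndependence

section HotellingStatistic

variable {d B : ℕ}

/-- Hotelling's `T²` statistic `uᵀ (B⁻¹ ∑_b v_b v_bᵀ)⁻¹ u` of a pair `(u, v)`; both the Hotelling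
distribution and the confidence region are expressed through it. It is `0` when the second-moment
matrix is singular. -/
noncomputable def hotellingStat
    (p : EuclideanSpace ℝ (Fin d) × (Fin B → EuclideanSpace ℝ (Fin d))) : ℝ :=
  invForm (secondMoment p.2) p.1

lemma secondMoment_toEuclideanCLM (A : Matrix (Fin d) (Fin d) ℝ)
    (v : Fin B → EuclideanSpace ℝ (Fin d)) :
    secondMoment (fun b => Matrix.toEuclideanCLM (𝕜 := ℝ) A (v b)) = A * secondMoment v * Aᵀ := by
  simp only [secondMoment, Matrix.ofLp_toEuclideanCLM, Matrix.mul_smul, Matrix.smul_mul,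
    Matrix.mul_sum, Matrix.sum_mul, Matrix.mul_vecMulVec, Matrix.vecMulVec_mul,
    Matrix.vecMul_transpose]

lemma secondMoment_smul (c : ℝ) (v : Fin B → EuclideanSpace ℝ (Fin d)) :
    secondMoment (fun b => c • v b) = c ^ 2 • secondMoment v := by
  simp only [secondMoment, WithLp.ofLp_smul, Matrix.smul_vecMulVec, Matrix.vecMulVec_smul,
    ← Finset.smul_sum, smul_smul]
  congr 1
  ring

lemma isUnit_det_secondMoment_smul_iff {c : ℝ} (hc : c ≠ 0)
    (v : Fin B → EuclideanSpace ℝ (Fin d)) :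
    IsUnit (secondMoment fun b => c • v b).det ↔ IsUnit (secondMoment v).det := by
  rw [secondMoment_smul, Matrix.det_smul, IsUnit.mul_iff]
  exact and_iff_right ((hc.isUnit.pow 2).pow _)

lemma hotellingStat_toEuclideanCLM {A : Matrix (Fin d) (Fin d) ℝ} (hA : IsUnit A.det)
    (u : EuclideanSpace ℝ (Fin d)) (v : Fin B → EuclideanSpace ℝ (Fin d)) :
    hotellingStat (Matrix.toEuclideanCLM (𝕜 := ℝ) A u,
      fun b => Matrix.toEuclideanCLM (𝕜 := ℝ) A (v b)) = hotellingStat (u, v) := by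
  have hAt : IsUnit Aᵀ.det := by rwa [Matrix.det_transpose]
  calc hotellingStat (Matrix.toEuclideanCLM (𝕜 := ℝ) A u,
        fun b => Matrix.toEuclideanCLM (𝕜 := ℝ) A (v b))
      = (A *ᵥ u.ofLp) ⬝ᵥ (((A * secondMoment v * Aᵀ)⁻¹ * A) *ᵥ u.ofLp) := by
        rw [hotellingStat, invForm, secondMoment_toEuclideanCLM, Matrix.ofLp_toEuclideanCLM,
          Matrix.mulVec_mulVec]
    _ = u.ofLp ⬝ᵥ ((Aᵀ * (A * secondMoment v * Aᵀ)⁻¹ * A) *ᵥ u.ofLp) := by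
        rw [← Matrix.vecMul_transpose, ← Matrix.dotProduct_mulVec, Matrix.mulVec_mulVec,
          ← mul_assoc]
    _ = hotellingStat (u, v) := by
        rw [Matrix.mul_inv_rev, Matrix.mul_inv_rev, ← mul_assoc, Matrix.mul_nonsing_inv _ hAt,
          one_mul, mul_assoc, Matrix.nonsing_inv_mul _ hA, mul_one, hotellingStat, invForm]

lemma hotellingStat_smul {c : ℝ} (hc : c ≠ 0) (u : EuclideanSpace ℝ (Fin d))
    (v : Fin B → EuclideanSpace ℝ (Fin d)) :
    hotellingStat (c • u, fun b => c • v b) = hotellingStat (u, v) := by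
  have hA : IsUnit (c • (1 : Matrix (Fin d) (Fin d) ℝ)).det := by
    rw [Matrix.det_smul, Matrix.det_one, mul_one]
    exact hc.isUnit.pow _
  simpa only [map_smul, map_one, smul_apply, one_apply_eq_self] using
    hotellingStat_toEuclideanCLM hA u v

lemma hotellingStat_eq_div (p : EuclideanSpace ℝ (Fin d) × (Fin B → EuclideanSpace ℝ (Fin d))) :
    hotellingStat p =
      (p.1.ofLp ⬝ᵥ ((secondMoment p.2).adjugate *ᵥ p.1.ofLp)) / (secondMoment p.2).det := by
  rw [hotellingStat, invForm, Matrix.inv_def, Ring.inverse_eq_inv', Matrix.smul_mulVec,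
    dotProduct_smul, smul_eq_mul, div_eq_inv_mul]

lemma continuous_secondMoment :
    Continuous (secondMoment : (Fin B → EuclideanSpace ℝ (Fin d)) → Matrix (Fin d) (Fin d) ℝ) := by
  unfold secondMoment
  have hofLp (b : Fin B) : Continuous fun v : Fin B → EuclideanSpace ℝ (Fin d) => (v b).ofLp := by
    fun_prop
  exact (continuous_finsetSum Finset.univ fun b _ =>
    (hofLp b).matrix_vecMulVec (hofLp b)).const_smul (B : ℝ)⁻¹

lemma continuous_dotProduct_adjugate_secondMoment :
    Continuous fun p : EuclideanSpace ℝ (Fin d) × (Fin B → EuclideanSpace ℝ (Fin d)) =>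
      p.1.ofLp ⬝ᵥ ((secondMoment p.2).adjugate *ᵥ p.1.ofLp) := by
  have hofLp : Continuous fun p : EuclideanSpace ℝ (Fin d) × (Fin B → EuclideanSpace ℝ (Fin d)) =>
    p.1.ofLp := by fun_prop
  exact hofLp.dotProduct
    ((continuous_secondMoment.comp continuous_snd).matrix_adjugate.matrix_mulVec hofLp)

lemma measurable_hotellingStat : Measurable (hotellingStat (d := d) (B := B)) := by
  simp_rw [funext hotellingStat_eq_div]
  exact continuous_dotProduct_adjugate_secondMoment.measurable.div
    (continuous_secondMoment.comp continuous_snd).matrix_det.measurable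

lemma continuousAt_hotellingStat
    {p : EuclideanSpace ℝ (Fin d) × (Fin B → EuclideanSpace ℝ (Fin d))}
    (hp : IsUnit (secondMoment p.2).det) : ContinuousAt hotellingStat p := by
  simp_rw [funext hotellingStat_eq_div]
  exact continuous_dotProduct_adjugate_secondMoment.continuousAt.div
    (continuous_secondMoment.comp continuous_snd).matrix_det.continuousAt hp.ne_zero

lemma mem_frontier_of_mem_frontier_preimage {X Y : Type*} [TopologicalSpace X] [TopologicalSpace Y]
    {f : X → Y} {s : Set Y} {x : X} (hf : ContinuousAt f x) (hx : x ∈ frontier (f ⁻¹' s)) :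
    f x ∈ frontier s := by
  rw [frontier_eq_closure_inter_closure] at hx ⊢
  exact ⟨closure_mono (Set.image_preimage_subset f s) (mem_closure_image hf hx.1),
    closure_mono (Set.image_preimage_subset f sᶜ) (mem_closure_image hf hx.2)⟩

lemma isOpen_isUnit_det_secondMoment :
    IsOpen {p : EuclideanSpace ℝ (Fin d) × (Fin B → EuclideanSpace ℝ (Fin d)) |
      IsUnit (secondMoment p.2).det} := by
  simp only [isUnit_iff_ne_zero]
  exact isOpen_ne_fun (continuous_secondMoment.comp continuous_snd).matrix_det continuous_const

lemma dotProduct_secondMoment_mulVec (v : Fin B → EuclideanSpace ℝ (Fin d)) (x : Fin d → ℝ) :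
    x ⬝ᵥ (secondMoment v *ᵥ x) = (B : ℝ)⁻¹ * ∑ b, (x ⬝ᵥ (v b).ofLp) ^ 2 := by
  simp only [secondMoment, Matrix.smul_mulVec, Matrix.sum_mulVec, Matrix.vecMulVec_mulVec,
    op_smul_eq_smul, dotProduct_smul, dotProduct_sum, smul_eq_mul, dotProduct_comm _ x, sq]

lemma posDef_secondMoment {v : Fin B → EuclideanSpace ℝ (Fin d)}
    (hv : Submodule.span ℝ (Set.range v) = ⊤) : (secondMoment v).PosDef := by
  refine .of_dotProduct_mulVec_pos ?_ fun x hx => ?_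
  · simp only [Matrix.IsHermitian, Matrix.conjTranspose_eq_transpose_of_trivial, secondMoment,
      Matrix.transpose_smul, Matrix.transpose_sum, Matrix.transpose_vecMulVec]
  obtain ⟨b, hb⟩ : ∃ b, x ⬝ᵥ (v b).ofLp ≠ 0 := by
    by_contra! horth
    have hzero : innerSL ℝ (WithLp.toLp 2 x : EuclideanSpace ℝ (Fin d)) = 0 :=
      ContinuousLinearMap.coe_injective <| LinearMap.ext_on_range hv fun b => by
        simpa [EuclideanSpace.inner_eq_star_dotProduct, dotProduct_comm] using horth b
    exact hx <| dotProduct_self_eq_zero.1 <| by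
      simpa [EuclideanSpace.inner_eq_star_dotProduct] using
        DFunLike.congr_fun hzero (WithLp.toLp 2 x)
  have hB : (0 : ℝ) < B := Nat.cast_pos.2 b.pos
  rw [star_trivial, dotProduct_secondMoment_mulVec]
  exact mul_pos (inv_pos.2 hB) <|
    Finset.sum_pos' (fun _ _ => sq_nonneg _) ⟨b, Finset.mem_univ b, by positivity⟩

end HotellingStatistic

section SpanningSamples

lemma ae_pi_of_ae_ae_cons {E : Type*} [MeasurableSpace E] {n : ℕ} {ν : Fin (n + 1) → Measure E}
    [∀ i, SigmaFinite (ν i)] {p : (Fin (n + 1) → E) → Prop} (hp : MeasurableSet {v | p v})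
    (h : ∀ᵐ v ∂Measure.pi fun i : Fin n => ν i.succ, ∀ᵐ x ∂ν 0, p (Fin.cons x v)) :
    ∀ᵐ v ∂Measure.pi ν, p v := by
  have hcons : Measurable fun z : E × (Fin n → E) => (Fin.cons z.1 z.2 : Fin (n + 1) → E) :=
    measurable_pi_lambda _ <| Fin.cases measurable_fst fun j =>
      (measurable_pi_apply j).comp measurable_snd
  have hprod : ∀ᵐ z ∂(ν 0).prod (Measure.pi fun i : Fin n => ν i.succ),
      p (Fin.cons z.1 z.2 : Fin (n + 1) → E) :=
    (Measure.ae_prod_iff_ae_ae (hcons hp)).2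
      ((Measure.ae_ae_comm (p := fun x v => p (Fin.cons x v)) (hcons hp)).2 h)
  filter_upwards [(measurePreserving_piFinSuccAbove ν 0).quasiMeasurePreserving.ae hprod] with v hv
  exact Fin.cons_self_tail v ▸ hv

lemma ae_pi_of_ae_tail {E : Type*} [MeasurableSpace E] {n : ℕ} {ν : Fin (n + 1) → Measure E}
    [∀ i, SigmaFinite (ν i)] {p : (Fin n → E) → Prop}
    (h : ∀ᵐ v ∂Measure.pi fun i : Fin n => ν i.succ, p v) :
    ∀ᵐ v ∂Measure.pi ν, p (Fin.tail v) :=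
  (measurePreserving_piFinSuccAbove ν 0).quasiMeasurePreserving.ae
    (Measure.quasiMeasurePreserving_snd.ae h)

variable {E : Type*} [NormedAddCommGroup E] [NormedSpace ℝ E] [FiniteDimensional ℝ E]
  [MeasurableSpace E] [BorelSpace E] {ν : Measure E} [SigmaFinite ν]

lemma ae_linearIndependent_of_submodule_null (hν : ∀ W : Submodule ℝ E, W ≠ ⊤ → ν W = 0) {k : ℕ}
    (hk : k ≤ Module.finrank ℝ E) :
    ∀ᵐ v ∂Measure.pi fun _ : Fin k => ν, LinearIndependent ℝ v := by
  induction k with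
  | zero => exact ae_of_all _ fun _ => linearIndependent_empty_type
  | succ k ih =>
    refine ae_pi_of_ae_ae_cons isOpen_setOfPred_linearIndependent.measurableSet ?_
    filter_upwards [ih (Nat.le_of_succ_le hk)] with v hv
    have hspan : Submodule.span ℝ (Set.range v) ≠ ⊤ := fun h => by
      rw [← finrank_top ℝ E, ← h, finrank_span_eq_card hv, Fintype.card_fin] at hk
      exact k.not_succ_le_self hk
    filter_upwards [measure_eq_zero_iff_ae_notMem.1 (hν _ hspan)] with x hx
    exact linearIndependent_finCons.2 ⟨hv, hx⟩

lemma ae_span_eq_top_of_submodule_null (hν : ∀ W : Submodule ℝ E, W ≠ ⊤ → ν W = 0) {k : ℕ}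
    (hk : Module.finrank ℝ E ≤ k) :
    ∀ᵐ v ∂Measure.pi fun _ : Fin k => ν, Submodule.span ℝ (Set.range v) = ⊤ := by
  induction k, hk using Nat.le_induction with
  | base =>
    filter_upwards [ae_linearIndependent_of_submodule_null hν le_rfl] with v hv
    exact hv.span_eq_top_of_card_eq_finrank' (Fintype.card_fin _)
  | succ k _ ih =>
    filter_upwards [ae_pi_of_ae_tail ih] with v hv
    exact top_unique (hv.ge.trans (Submodule.span_mono (Set.range_comp_subset_range Fin.succ v)))

end SpanningSamples

section AbsoluteContinuity

open scoped MatrixOrder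

lemma absolutelyContinuous_pi {E : Type*} [MeasurableSpace E] {n : ℕ} {ρ ν : Fin n → Measure E}
    [∀ i, SigmaFinite (ρ i)] [∀ i, SigmaFinite (ν i)] (h : ∀ i, ρ i ≪ ν i) :
    Measure.pi ρ ≪ Measure.pi ν := by
  induction n with
  | zero => rw [Measure.pi_of_empty ρ, Measure.pi_of_empty ν]
  | succ n ih =>
    rw [← (measurePreserving_piFinSuccAbove ρ 0).symm.map_eq,
      ← (measurePreserving_piFinSuccAbove ν 0).symm.map_eq]
    exact ((h 0).prod (ih fun i => h i.succ)).map (MeasurableEquiv.measurable _)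

variable {d : ℕ}

lemma stdGaussian_absolutelyContinuous : stdGaussian (EuclideanSpace ℝ (Fin d)) ≪ volume := by
  rw [← map_pi_eq_stdGaussian, ← (PiLp.volume_preserving_toLp (Fin d)).map_eq]
  exact (absolutelyContinuous_pi fun _ =>
    gaussianReal_absolutelyContinuous 0 one_ne_zero).map (by fun_prop)

lemma isUnit_det_sqrt_of_posDef {A : Matrix (Fin d) (Fin d) ℝ} (hA : A.PosDef) :
    IsUnit (CFC.sqrt A).det :=
  (Matrix.isUnit_iff_isUnit_det _).1 ((CFC.isUnit_sqrt_iff A hA.posSemidef.nonneg).2 hA.isUnit)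

lemma quasiMeasurePreserving_toEuclideanCLM {A : Matrix (Fin d) (Fin d) ℝ} (hA : IsUnit A.det) :
    Measure.QuasiMeasurePreserving (Matrix.toEuclideanCLM (𝕜 := ℝ) A) := by
  refine Measure.ContinuousLinearMap.quasiMeasurePreserving volume _ ?_
  rw [ContinuousLinearMap.det, Matrix.coe_toEuclideanCLM_eq_toEuclideanLin, LinearMap.det_toLpLin]
  exact hA.ne_zero

lemma multivariateGaussian_absolutelyContinuous {C : Matrix (Fin d) (Fin d) ℝ} (hC : C.PosDef)
    (m : EuclideanSpace ℝ (Fin d)) : multivariateGaussian m C ≪ volume :=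
  (stdGaussian_absolutelyContinuous.map (by fun_prop)).trans <|
    ((measurePreserving_add_left volume m).quasiMeasurePreserving.comp
      (quasiMeasurePreserving_toEuclideanCLM (isUnit_det_sqrt_of_posDef hC))).absolutelyContinuous

lemma volume_setOf_dotProduct_mulVec_eq [NeZero d] {A : Matrix (Fin d) (Fin d) ℝ} (hA : A.PosDef)
    (c : ℝ) : volume {u : EuclideanSpace ℝ (Fin d) | u.ofLp ⬝ᵥ (A *ᵥ u.ofLp) = c} = 0 := by
  set S := CFC.sqrt A
  have hS : Sᵀ = S := (CFC.sqrt_nonneg A).isSelfAdjoint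
  refine measure_mono_null (t := Matrix.toEuclideanCLM (𝕜 := ℝ) S ⁻¹' Metric.sphere 0 √c) ?_ <|
    (quasiMeasurePreserving_toEuclideanCLM (isUnit_det_sqrt_of_posDef hA)).preimage_null
      (Measure.addHaar_sphere volume 0 √c)
  rintro u rfl
  have hnorm : ‖Matrix.toEuclideanCLM (𝕜 := ℝ) S u‖ ^ 2 = u.ofLp ⬝ᵥ (A *ᵥ u.ofLp) := by
    rw [← real_inner_self_eq_norm_sq, Matrix.inner_toEuclideanCLM, Matrix.ofLp_toEuclideanCLM,
      ← Matrix.vecMul_transpose, ← Matrix.dotProduct_mulVec, Matrix.vecMul_transpose,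
      Matrix.mulVec_mulVec, hS, CFC.sqrt_mul_sqrt_self A hA.posSemidef.nonneg]
  rw [Set.mem_preimage, mem_sphere_zero_iff_norm, ← hnorm, Real.sqrt_sq (norm_nonneg _)]

end AbsoluteContinuity

section LimitLaw

open scoped MatrixOrder

variable {d B : ℕ} {ν₀ ν : Measure (EuclideanSpace ℝ (Fin d))} [SigmaFinite ν]

lemma ae_isUnit_det_secondMoment (hν : ν ≪ volume) (hB : d ≤ B) :
    ∀ᵐ p ∂ν₀.prod (Measure.pi fun _ : Fin B => ν), IsUnit (secondMoment p.2).det := by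
  refine Measure.quasiMeasurePreserving_snd.ae (p := fun v => IsUnit (secondMoment v).det) ?_
  filter_upwards [ae_span_eq_top_of_submodule_null
    (fun W hW => hν (Measure.addHaar_submodule volume W hW))
    (finrank_euclideanSpace_fin.trans_le hB)] with v hv
  exact (Matrix.isUnit_iff_isUnit_det _).1 (posDef_secondMoment hv).isUnit

lemma ae_hotellingStat_ne [NeZero d] [SFinite ν₀] (hν₀ : ν₀ ≪ volume) (hν : ν ≪ volume)
    (hB : d ≤ B) (c : ℝ) :
    ∀ᵐ p ∂ν₀.prod (Measure.pi fun _ : Fin B => ν), hotellingStat p ≠ c := by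
  have hmeas : MeasurableSet {p : EuclideanSpace ℝ (Fin d) × (Fin B → EuclideanSpace ℝ (Fin d)) |
      hotellingStat p ≠ c} := measurable_hotellingStat (measurableSet_singleton c).compl
  rw [Measure.ae_prod_iff_ae_ae hmeas, Measure.ae_ae_comm hmeas]
  filter_upwards [ae_span_eq_top_of_submodule_null
    (fun W hW => hν (Measure.addHaar_submodule volume W hW))
    (finrank_euclideanSpace_fin.trans_le hB)] with v hv
  exact measure_eq_zero_iff_ae_notMem.1
    (hν₀ (volume_setOf_dotProduct_mulVec_eq (posDef_secondMoment hv).inv c))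

lemma measure_frontier_isUnit_det_secondMoment (hν : ν ≪ volume) (hB : d ≤ B) :
    ν₀.prod (Measure.pi fun _ : Fin B => ν) (frontier {p | IsUnit (secondMoment p.2).det}) = 0 := by
  rw [isOpen_isUnit_det_secondMoment.frontier_eq]
  exact measure_mono_null (fun _ hp => hp.2) (ae_isUnit_det_secondMoment hν hB)

lemma measure_frontier_preimage_hotellingStat [NeZero d] [SFinite ν₀] (hν₀ : ν₀ ≪ volume)
    (hν : ν ≪ volume) (hB : d ≤ B) (q : ℝ) :
    ν₀.prod (Measure.pi fun _ : Fin B => ν) (frontier (hotellingStat ⁻¹' Set.Iic q)) = 0 := by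
  rw [measure_eq_zero_iff_ae_notMem]
  filter_upwards [ae_isUnit_det_secondMoment hν hB, ae_hotellingStat_ne hν₀ hν hB q]
    with p hdet hne hp
  have hq := mem_frontier_of_mem_frontier_preimage (continuousAt_hotellingStat hdet) hp
  rw [frontier_Iic] at hq
  exact hne hq

instance isProbabilityMeasure_hotelling : IsProbabilityMeasure (hotelling d B) :=
  Measure.isProbabilityMeasure_map measurable_hotellingStat.aemeasurable

lemma nullSingletonClass_hotelling [NeZero d] (hB : d ≤ B) :
    NullSingletonClass (hotelling d B) where
  measure_singleton c :=
    (Measure.map_apply measurable_hotellingStat (measurableSet_singleton c)).trans <|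
      measure_eq_zero_iff_ae_notMem.2 <|
        ae_hotellingStat_ne stdGaussian_absolutelyContinuous stdGaussian_absolutelyContinuous hB c

lemma map_hotellingStat_multivariateGaussian {C : Matrix (Fin d) (Fin d) ℝ} (hC : C.PosDef) :
    ((multivariateGaussian 0 C).prod (Measure.pi fun _ : Fin B => multivariateGaussian 0 C)).map
      hotellingStat = hotelling d B := by
  have hL : Measurable (Matrix.toEuclideanCLM (𝕜 := ℝ) (CFC.sqrt C)) := by fun_prop
  simp only [multivariateGaussian, zero_add]
  rw [← Measure.pi_map_pi fun _ => hL.aemeasurable, Measure.map_prod_map _ _ hL (by fun_prop),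
    Measure.map_map measurable_hotellingStat (by fun_prop), hotelling]
  congr 1
  ext p
  exact hotellingStat_toEuclideanCLM (isUnit_det_sqrt_of_posDef hC) p.1 p.2

end LimitLaw

section Quantile

variable {ρ : Measure ℝ} [IsProbabilityMeasure ρ] [NullSingletonClass ρ]

lemma continuous_cdf : Continuous (cdf ρ) := by
  refine continuous_iff_continuousAt.2 fun x => ?_
  have hsub : cdf ρ x - Function.leftLim (cdf ρ) x ≤ 0 := by
    rw [← ENNReal.ofReal_eq_zero, ← StieltjesFunction.measure_singleton, measure_cdf,
      measure_singleton]
  rw [(cdf ρ).mono.continuousAt_iff_leftLim_eq_rightLim, StieltjesFunction.rightLim_eq]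
  exact le_antisymm ((cdf ρ).mono.leftLim_le le_rfl) (sub_nonpos.1 hsub)

lemma measureReal_Iic_quantile {p : ℝ} (hp0 : 0 < p) (hp1 : p < 1) :
    ρ.real (Set.Iic (quantile ρ p)) = p := by
  have hquantile : quantile ρ p = sInf {x | p ≤ cdf ρ x} := by
    simp only [quantile, cdf_eq_real]
  obtain ⟨a, ha⟩ := ((tendsto_cdf_atBot ρ).eventually_lt_const hp0).exists
  obtain ⟨b, hb⟩ := ((tendsto_cdf_atTop ρ).eventually_const_lt hp1).exists
  obtain ⟨x, hx⟩ : p ∈ Set.range (cdf ρ) :=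
    mem_range_of_exists_le_of_exists_ge continuous_cdf ⟨a, ha.le⟩ ⟨b, hb.le⟩
  have hbdd : BddBelow {x | p ≤ cdf ρ x} :=
    ⟨a, fun y hy => ((cdf ρ).mono.reflect_lt (ha.trans_le hy)).le⟩
  have hmem : p ≤ cdf ρ (quantile ρ p) :=
    hquantile ▸ (isClosed_le continuous_const continuous_cdf).csInf_mem ⟨x, hx.ge⟩ hbdd
  have hle : quantile ρ p ≤ x := hquantile ▸ csInf_le hbdd hx.ge
  rw [← cdf_eq_real]
  exact le_antisymm (((cdf ρ).mono hle).trans hx.le) hmem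

end Quantile

section JointConvergence

variable {Ω : Type*} [MeasurableSpace Ω] {μ : Measure Ω}

lemma abs_condExp_indicator_one_le {m : MeasurableSpace Ω} (s : Set Ω) :
    ∀ᵐ ω ∂μ, |(μ⟦s | m⟧) ω| ≤ 1 :=
  ae_bdd_abs_condExp_of_ae_bdd_abs <| ae_of_all _ fun ω => by
    rw [← Real.norm_eq_abs]
    exact (norm_indicator_le_norm_self _ _).trans norm_one.le

variable [IsProbabilityMeasure μ]

lemma tendsto_measureReal_of_null_frontier {ι E : Type*} {l : Filter ι} [TopologicalSpace E]
    [MeasurableSpace E] [OpensMeasurableSpace E] [HasOuterApproxClosed E] {ν : Measure E}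
    [IsProbabilityMeasure ν] {Z : ι → Ω → E} (h : TendstoInDistribution Z l id (fun _ => μ) ν)
    {S : Set E} (hS : MeasurableSet S) (hfr : ν (frontier S) = 0) :
    Tendsto (fun n => μ.real (Z n ⁻¹' S)) l (𝓝 (ν.real S)) := by
  have hmeasure := (ENNReal.tendsto_toReal (measure_ne_top (ν.map id) S)).comp <|
    ProbabilityMeasure.tendsto_measure_of_null_frontier_of_tendsto' h.tendsto
      (by simpa only [ProbabilityMeasure.coe_mk, Measure.map_id] using hfr)
  rw [Measure.map_id] at hmeasure
  exact hmeasure.congr fun n =>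
    congrArg ENNReal.toReal (Measure.map_apply_of_aemeasurable (h.forall_aemeasurable n) hS)

lemma tendsto_setIntegral_prod_condExp {ι κ : Type*} [Fintype κ] {l : Filter ι}
    [l.IsCountablyGenerated] {m : ι → MeasurableSpace Ω} {A : ι → Set Ω} {s : ι → κ → Set Ω}
    {a : ℝ} {c : κ → ℝ} (hA : Tendsto (fun n => μ.real (A n)) l (𝓝 a))
    (hs : ∀ b, TendstoInMeasure μ (fun n => μ⟦s n b | m n⟧) l fun _ => c b) :
    Tendsto (fun n => ∫ ω in A n, ∏ b, (μ⟦s n b | m n⟧) ω ∂μ) l (𝓝 (a * ∏ b, c b)) := by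
  have hmeas (n : ι) : AEStronglyMeasurable (fun ω => ∏ b, (μ⟦s n b | m n⟧) ω) μ :=
    Finset.aestronglyMeasurable_fun_prod _ fun b _ => integrable_condExp.aestronglyMeasurable
  have hbound (n : ι) : ∀ᵐ ω ∂μ, ‖∏ b, (μ⟦s n b | m n⟧) ω‖ ≤ 1 := by
    filter_upwards [ae_all_iff.2 fun b => abs_condExp_indicator_one_le (m := m n) (s n b)]
      with ω hω
    rw [norm_prod]
    exact Finset.prod_le_one (fun _ _ => norm_nonneg _) fun b _ => hω b
  exact tendsto_setIntegral_of_tendsto_integral_abs_sub hA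
    (fun n => .of_bound (hmeas n) 1 (hbound n))
    (tendsto_integral_norm_comp_sub_of_tendstoInMeasure (φ := fun z : κ → ℝ => ∏ b, z b)
      (tendstoInMeasure_pi hs) (by fun_prop) hmeas hbound)

variable {d : ℕ} {α β : ℕ+ → Type*} [∀ n, MeasurableSpace (α n)] [∀ n, MeasurableSpace (β n)]

/- Given `Y n`, the variables `g n b (Y n, K n b)` are independent, so their conditional joint
distribution function is the product of the marginal ones, and that product converges to a
constant. -/
lemma tendstoInDistribution_prod_pi_of_condTendstoInDistribution {κ : Type*} [Fintype κ]
    {Y : ∀ n, Ω → α n} {K : ∀ n, κ → Ω → β n} (hY : ∀ n, Measurable (Y n))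
    (hK : ∀ n b, Measurable (K n b)) (hKind : ∀ n, iIndepFun (K n) μ)
    (hYK : ∀ n, IndepFun (Y n) (fun ω b => K n b ω) μ)
    {f : ∀ n, α n → EuclideanSpace ℝ (Fin d)} {g : ∀ n, κ → α n × β n → EuclideanSpace ℝ (Fin d)}
    (hf : ∀ n, Measurable (f n)) (hg : ∀ n b, Measurable (g n b))
    {ν₀ : Measure (EuclideanSpace ℝ (Fin d))} [IsProbabilityMeasure ν₀] (hν₀ : ν₀ ≪ volume)
    {ν : κ → Measure (EuclideanSpace ℝ (Fin d))} [∀ b, IsProbabilityMeasure (ν b)]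
    (hU : TendstoInDistribution (fun n ω => f n (Y n ω)) atTop id (fun _ => μ) ν₀)
    (hD : ∀ b, CondTendstoInDistribution μ (fun n ω => g n b (Y n ω, K n b ω))
      (fun n => MeasurableSpace.comap (Y n) inferInstance) (ν b)) :
    TendstoInDistribution (fun n ω => (f n (Y n ω), fun b => g n b (Y n ω, K n b ω))) atTop id
      (fun _ => μ) (ν₀.prod (Measure.pi ν)) := by
  refine tendstoInDistribution_prod_pi_of_tendsto_orthant (fun n => (hf n).comp (hY n))
    (fun n b => (hg n b).comp ((hY n).prodMk (hK n b))) fun x y => ?_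
  have hmarg : Tendsto (fun n => μ.real ((fun ω => f n (Y n ω)) ⁻¹' orthant x)) atTop
      (𝓝 (ν₀.real (orthant x))) :=
    tendsto_measureReal_of_null_frontier hU (measurableSet_orthant x)
      (hν₀ ((convex_orthant x).addHaar_frontier volume))
  refine (tendsto_setIntegral_prod_condExp hmarg fun b => hD b (y b)).congr fun n => ?_
  exact (measureReal_inter_forall_eq_setIntegral_prod_condExp (hY n) (hK n) (hKind n) (hYK n)
    (hf n (measurableSet_orthant x)) fun b => hg n b (measurableSet_orthant (y b))).symm

end JointConvergence

section LimitProbabilities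

variable {Ω ι : Type*} [MeasurableSpace Ω] {μ : Measure Ω} [IsProbabilityMeasure μ] {l : Filter ι}
  {d B : ℕ} {Z : ι → Ω → EuclideanSpace ℝ (Fin d) × (Fin B → EuclideanSpace ℝ (Fin d))}

lemma tendsto_measureReal_isUnit_det_secondMoment
    {ν₀ ν : Measure (EuclideanSpace ℝ (Fin d))} [IsProbabilityMeasure ν₀] [IsProbabilityMeasure ν]
    (hν : ν ≪ volume) (hB : d ≤ B)
    (h : TendstoInDistribution Z l id (fun _ => μ) (ν₀.prod (Measure.pi fun _ => ν))) :
    Tendsto (fun n => μ.real {ω | IsUnit (secondMoment (Z n ω).2).det}) l (𝓝 1) := by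
  have hlim := tendsto_measureReal_of_null_frontier h
    isOpen_isUnit_det_secondMoment.measurableSet (measure_frontier_isUnit_det_secondMoment hν hB)
  rwa [measureReal_def, prob_compl_eq_zero_iff isOpen_isUnit_det_secondMoment.measurableSet |>.1
    (ae_isUnit_det_secondMoment hν hB), ENNReal.toReal_one] at hlim

lemma tendsto_measureReal_hotellingStat_le [NeZero d] (hB : d ≤ B)
    {C : Matrix (Fin d) (Fin d) ℝ} (hC : C.PosDef)
    (h : TendstoInDistribution Z l id (fun _ => μ)
      ((multivariateGaussian 0 C).prod (Measure.pi fun _ => multivariateGaussian 0 C))) (q : ℝ) :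
    Tendsto (fun n => μ.real {ω | hotellingStat (Z n ω) ≤ q}) l
      (𝓝 ((hotelling d B).real (Set.Iic q))) := by
  have hac := multivariateGaussian_absolutelyContinuous hC 0
  rw [← map_hotellingStat_multivariateGaussian hC,
    map_measureReal_apply measurable_hotellingStat measurableSet_Iic]
  exact tendsto_measureReal_of_null_frontier h (measurable_hotellingStat measurableSet_Iic)
    (measure_frontier_preimage_hotellingStat hac hac hB q)

end LimitProbabilities

section Independence

lemma iIndepFun_curry {Ω ι κ 𝓧 : Type*} [MeasurableSpace Ω] [MeasurableSpace 𝓧] [Countable ι]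
    [Countable κ] {μ : Measure Ω} [IsProbabilityMeasure μ] {X : ι × κ → Ω → 𝓧}
    (hX : ∀ p, Measurable (X p)) (h : iIndepFun X μ) :
    iIndepFun (fun i ω j => X (i, j) ω) μ := by
  have hprob (p) := Measure.isProbabilityMeasure_map (μ := μ) (hX p).aemeasurable
  have hrow (i : ι) : μ.map (fun ω j => X (i, j) ω) =
      Measure.infinitePi fun j => μ.map (X (i, j)) :=
    (h.precomp (Prod.mk_right_injective i)).map_fun_eq_infinitePi_map fun j => hX (i, j)
  rw [iIndepFun_iff_map_fun_eq_infinitePi_map fun i => measurable_pi_lambda _ fun j => hX (i, j)]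
  simp_rw [hrow]
  rw [← Measure.infinitePi_map_curry (fun i j => μ.map (X (i, j))),
    ← h.map_fun_eq_infinitePi_map hX, Measure.map_map (by fun_prop) (by fun_prop)]
  rfl

end Independence

section Bootstrap

variable {𝒳 Ω : Type*} [MeasurableSpace 𝒳] {d B : ℕ}
  {ψ : ProbabilityMeasure 𝒳 → EuclideanSpace ℝ (Fin d)} {X : ℕ → Ω → 𝒳}
  {J : (n : ℕ+) → Fin B → Fin n → Ω → Fin n}

lemma isUnit_det_resampleCov_iff (n : ℕ+) (ω : Ω) :
    IsUnit (resampleCov ψ X J n ω).det ↔ IsUnit (secondMoment fun b : Fin B =>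
      √(n : ℝ) • (resampleEstimate ψ X J n b ω - estimate ψ X n ω)).det :=
  (isUnit_det_secondMoment_smul_iff (Real.sqrt_pos.2 (Nat.cast_pos.2 n.pos)).ne' _).symm

lemma mem_region_iff (α : ℝ) (n : ℕ+) (ω : Ω) (θ : EuclideanSpace ℝ (Fin d)) :
    θ ∈ region ψ X J α n ω ↔ hotellingStat (√(n : ℝ) • (estimate ψ X n ω - θ), fun b : Fin B =>
      √(n : ℝ) • (resampleEstimate ψ X J n b ω - estimate ψ X n ω)) ≤
        quantile (hotelling d B) (1 - α) := by
  rw [hotellingStat_smul (Real.sqrt_pos.2 (Nat.cast_pos.2 n.pos)).ne']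
  rfl

variable [MeasurableSpace Ω] {μ : Measure Ω}

lemma IsResampling.iIndepFun_row [IsProbabilityMeasure μ] (hJ : IsResampling μ X J) (n : ℕ+) :
    iIndepFun (fun b ω i => J n b i ω) μ :=
  iIndepFun_curry (X := fun p : Fin B × Fin n => J n p.1 p.2)
    (fun p => hJ.measurable n p.1 p.2) (hJ.indep n)

lemma IsResampling.indepFun_data_row (hJ : IsResampling μ X J) (n : ℕ+) :
    IndepFun (data X n) (fun ω b i => J n b i ω) μ := by
  have hcurry : Measurable fun (k : Fin B × Fin n → Fin n) b i => k (b, i) := by fun_prop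
  exact (hJ.indep_data n).comp measurable_id hcurry

lemma measurable_empirical_resample {n : ℕ+}
    (hψ : Measurable fun x : Fin n → 𝒳 => ψ (empirical x)) :
    Measurable fun p : (Fin n → 𝒳) × (Fin n → Fin n) =>
      ψ (empirical fun i : Fin n => p.1 (p.2 i)) :=
  measurable_from_prod_countable_left fun j =>
    hψ.comp (measurable_pi_lambda _ fun i => measurable_pi_apply (j i))

theorem tendstoInDistribution_estimate_prod_resampleEstimate [IsProbabilityMeasure μ]
    (hψ : ∀ n : ℕ+, Measurable fun x : Fin n → 𝒳 => ψ (empirical x))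
    (hX : ∀ i, Measurable (X i)) (hJ : ∀ n b i, Measurable (J n b i))
    (hJindep : ∀ n, iIndepFun (fun b ω i => J n b i ω) μ)
    (hJdata : ∀ n, IndepFun (data X n) (fun ω b i => J n b i ω) μ)
    {θ : EuclideanSpace ℝ (Fin d)} {ν₀ : Measure (EuclideanSpace ℝ (Fin d))}
    [IsProbabilityMeasure ν₀] (hν₀ : ν₀ ≪ volume)
    {ν : Fin B → Measure (EuclideanSpace ℝ (Fin d))} [∀ b, IsProbabilityMeasure (ν b)]
    (hclt : TendstoInDistribution (fun (n : ℕ+) ω => √(n : ℝ) • (estimate ψ X n ω - θ)) atTop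
      id (fun _ => μ) ν₀)
    (hboot : ∀ b : Fin B, CondTendstoInDistribution μ
      (fun n ω => √(n : ℝ) • (resampleEstimate ψ X J n b ω - estimate ψ X n ω))
      (dataSigma X) (ν b)) :
    TendstoInDistribution (fun (n : ℕ+) ω => (√(n : ℝ) • (estimate ψ X n ω - θ),
      fun b => √(n : ℝ) • (resampleEstimate ψ X J n b ω - estimate ψ X n ω))) atTop
      id (fun _ => μ) (ν₀.prod (Measure.pi ν)) :=
  tendstoInDistribution_prod_pi_of_condTendstoInDistribution (Y := data X)
    (K := fun n b ω i => J n b i ω) (f := fun n x => √(n : ℝ) • (ψ (empirical x) - θ))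
    (g := fun n _ p =>
      √(n : ℝ) • (ψ (empirical fun i : Fin n => p.1 (p.2 i)) - ψ (empirical p.1)))
    (fun _ => measurable_pi_lambda _ fun i => hX i) (fun n b => measurable_pi_lambda _ (hJ n b))
    hJindep hJdata (fun n => ((hψ n).sub_const θ).fun_const_smul _)
    (fun n _ => ((measurable_empirical_resample (hψ n)).fun_sub
      ((hψ n).comp measurable_fst)).fun_const_smul _)
    hν₀ hclt hboot

end Bootstrap

end CheapBootstrap

open CheapBootstrap in
theorem theorem8_general {𝒳 Ω : Type*} [MeasurableSpace 𝒳] [MeasurableSpace Ω] {μ : Measure Ω}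
    [IsProbabilityMeasure μ] {d B : ℕ} (hd : 1 ≤ d) (hB : d ≤ B)
    {ψ : ProbabilityMeasure 𝒳 → EuclideanSpace ℝ (Fin d)}
    (hψ : ∀ n : ℕ+, Measurable fun x : Fin n → 𝒳 => ψ (empirical x))
    {X : ℕ → Ω → 𝒳} (hX : ∀ i, Measurable (X i))
    {J : (n : ℕ+) → Fin B → Fin n → Ω → Fin n} (hJ : ∀ n b i, Measurable (J n b i))
    (hJindep : ∀ n, iIndepFun (fun b ω i => J n b i ω) μ)
    (hJdata : ∀ n, IndepFun (data X n) (fun ω b i => J n b i ω) μ)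
    {θ : EuclideanSpace ℝ (Fin d)} {C : Matrix (Fin d) (Fin d) ℝ} (hC : C.PosDef)
    (hclt : TendstoInDistribution (fun (n : ℕ+) ω => √(n : ℝ) • (estimate ψ X n ω - θ)) atTop
      id (fun _ => μ) (multivariateGaussian 0 C))
    (hboot : ∀ b : Fin B, CondTendstoInDistribution μ
      (fun n ω => √(n : ℝ) • (resampleEstimate ψ X J n b ω - estimate ψ X n ω))
      (dataSigma X) (multivariateGaussian 0 C))
    {α : ℝ} (hα0 : 0 < α) (hα1 : α < 1) :
    Tendsto (fun n : ℕ+ => μ.real {ω | IsUnit (resampleCov ψ X J n ω).det}) atTop (𝓝 1) ∧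
      Tendsto (fun n : ℕ+ => μ.real {ω | θ ∈ region ψ X J α n ω}) atTop (𝓝 (1 - α)) := by
  have : NeZero d := ⟨Nat.one_le_iff_ne_zero.1 hd⟩
  have hac := multivariateGaussian_absolutelyContinuous hC 0
  have hjoint := tendstoInDistribution_estimate_prod_resampleEstimate hψ hX hJ hJindep hJdata hac
    hclt hboot
  have := nullSingletonClass_hotelling hB
  have hquantile : (hotelling d B).real (Set.Iic (quantile (hotelling d B) (1 - α))) = 1 - α :=
    measureReal_Iic_quantile (sub_pos.2 hα1) (sub_lt_self 1 hα0)
  have hdet := tendsto_measureReal_isUnit_det_secondMoment hac hB hjoint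
  have hstat := tendsto_measureReal_hotellingStat_le hB hC hjoint (quantile (hotelling d B) (1 - α))
  rw [hquantile] at hstat
  simp only [isUnit_det_resampleCov_iff, mem_region_iff]
  exact ⟨hdet, hstat⟩

theorem theorem8 {𝒳 Ω : Type*} [MeasurableSpace 𝒳] [MeasurableSpace Ω]
    (μ : Measure Ω) [IsProbabilityMeasure μ]
    (d B : ℕ) (hd : 1 ≤ d) (hB : d ≤ B)
    (P : ProbabilityMeasure 𝒳) (ψ : ProbabilityMeasure 𝒳 → EuclideanSpace ℝ (Fin d))
    (hψ : ∀ n : ℕ+, Measurable fun x : Fin n → 𝒳 => ψ (CheapBootstrap.empirical x))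
    -- i.i.d. data with distribution `P`
    (X : ℕ → Ω → 𝒳) (hX : ∀ i, Measurable (X i)) (hXindep : iIndepFun X μ)
    (hXlaw : ∀ i, μ.map (X i) = (P : Measure 𝒳))
    -- `B` resamples with replacement for every sample size
    (J : (n : ℕ+) → Fin B → Fin n → Ω → Fin n) (hJ : CheapBootstrap.IsResampling μ X J)
    -- asymptotic normality, unconditional and conditional on the data
    (C : Matrix (Fin d) (Fin d) ℝ) (hC : C.PosDef)
    (hclt : TendstoInDistribution
      (fun (n : ℕ+) ω => √(n : ℝ) • (CheapBootstrap.estimate ψ X n ω - ψ P)) atTop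
      id (fun _ => μ) (multivariateGaussian 0 C))
    (hboot : ∀ b : Fin B, CheapBootstrap.CondTendstoInDistribution μ
      (fun n ω => √(n : ℝ) •
        (CheapBootstrap.resampleEstimate ψ X J n b ω - CheapBootstrap.estimate ψ X n ω))
      (CheapBootstrap.dataSigma X) (multivariateGaussian 0 C))
    (α : ℝ) (hα0 : 0 < α) (hα1 : α < 1) :
    Tendsto (fun n : ℕ+ => μ.real {ω | IsUnit (CheapBootstrap.resampleCov ψ X J n ω).det})
        atTop (𝓝 1) ∧
      Tendsto (fun n : ℕ+ => μ.real {ω | ψ P ∈ CheapBootstrap.region ψ X J α n ω})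
        atTop (𝓝 (1 - α)) :=
  theorem8_general hd hB hψ hX hJ.measurable hJ.iIndepFun_row hJ.indepFun_data_row hC hclt hboot
    hα0 hα1
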